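/- Let $L=\{a+bi+cj+dk : a,b,c,d\in\mathbb{Z}\}$, with $i^2=j^2=k^2=ijk=-1$, be the (non-commutative) ring of Lipschitz integer quaternions. Let $\beta L$ be the set of ultrafilters on $L$ with the addition for which $B\in p+q$ if and only if $\{x\in L:\{y\in L: x+y\in B\}\in q\}\in p$. A left ideal of $(\beta L,+)$ is a nonempty $I\subseteq\beta L$ with $\beta L+I\subseteq I$; it is minimal if it properly contains no left ideal. Let $K(\beta L)$ be the smallest two-sided ideal of $(\beta L,+)$, which is the union of all minimal left ideals. A set $A\subseteq L$ is central$^{*}$ in $(L,+)$ if $A\in p$ for every $p\in K(\beta L)$ with $p+p=p$. For a sequence $\langle x_n\rangle_{n=1}^{\infty}$ in $L$ and $m\ge 1$ let $$FS(\langle x_n\rangle_{n=m}^{\infty})=\Big\{\sum_{n\in F}x_n : F \text{ a finite nonempty subset of } \{m,m+1,\dots\}\Big\},$$ $$AP(\langle x_n\rangle_{n=1}^{\infty})=\{x_{n_1}x_{n_2}\cdots x_{n_k} : k\ge 1,\ n_1,\dots,n_k\in\mathbb{N} \text{ pairwise distinct, in any order}\}.$$ The sequence $\langle x_n\rangle_{n=1}^{\infty}$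 is minimal in $(L,+)$ if some $p\in K(\beta L)$ satisfies $FS(\langle x_n\rangle_{n=m}^{\infty})\in p$ for every $m\ge 1$. It is a sum subsystem of $\langle y_n\rangle_{n=1}^{\infty}$ if there are finite nonempty sets $H_n\subseteq\mathbb{N}$ with $\max H_n<\min H_{n+1}$ and $x_n=\sum_{t\in H_n}y_t$ for all $n$. **Theorem.** Let $A$ be a central$^{*}$ set in $(L,+)$ and let $\langle y_n\rangle_{n=1}^{\infty}$ be a minimal sequence in $(L,+)$. Then there is a sum subsystem $\langle x_n\rangle_{n=1}^{\infty}$ of $\langle y_n\rangle_{n=1}^{\infty}$ in $L$ such that $$FS(\langle x_n\rangle_{n=1}^{\infty})\cup AP(\langle x_n\rangle_{n=1}^{\infty})\subseteq A.$$ -/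

import Mathlib

/-!
The points of `βS` are the ultrafilters on the discrete space `S`; the extension of the addition
of `S` to `βS` is the one of Mathlib, for which `A ∈ p + q ↔ {x | {y | x + y ∈ A} ∈ q} ∈ p`.
-/

attribute [local instance] Ultrafilter.add

/-- A left ideal of `(T, +)`: a nonempty subset `I` with `T + I ⊆ I`. -/
def IsLeftIdeal {T : Type*} [Add T] (I : Set T) : Prop :=
  I.Nonempty ∧ ∀ t : T, ∀ x ∈ I, t + x ∈ I

/-- A left ideal that contains no other left ideal. -/
def IsMinimalLeftIdeal {T : Type*} [Add T] (I : Set T) : Prop :=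
  IsLeftIdeal I ∧ ∀ J : Set T, IsLeftIdeal J → J ⊆ I → J = I

/-- The smallest ideal `K(T)` of `(T, +)`, as the union of the minimal left ideals. -/
def smallestIdeal (T : Type*) [Add T] : Set T :=
  {x | ∃ I : Set T, IsMinimalLeftIdeal I ∧ x ∈ I}

/-- A minimal idempotent of `(T, +)`: an idempotent that lies in `K(T)`. -/
def IsMinimalIdempotent {T : Type*} [Add T] (p : T) : Prop :=
  p + p = p ∧ p ∈ smallestIdeal T

/-- `A` is central* in `(S, +)` if it is a member of every minimal idempotent of `(βS, +)`. -/
def IsCentralStar {S : Type*} [Add S] (A : Set S) : Prop :=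
  ∀ p : Ultrafilter S, IsMinimalIdempotent p → A ∈ p

/-- The sums over finite nonempty sets of terms with index at least `m`,
`FS(⟨x_n⟩_{n ≥ m})`. -/
def finiteSumsFrom {S : Type*} [AddCommMonoid S] (x : ℕ → S) (m : ℕ) : Set S :=
  {s | ∃ F : Finset ℕ, F.Nonempty ∧ (∀ t ∈ F, m ≤ t) ∧ s = ∑ t ∈ F, x t}

/-- The finite sums `FS(⟨x_n⟩)` of the whole sequence. -/
def finiteSums {S : Type*} [AddCommMonoid S] (x : ℕ → S) : Set S :=
  {s | ∃ F : Finset ℕ, F.Nonempty ∧ s = ∑ t ∈ F, x t}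

/-- `⟨x_n⟩` is a minimal sequence: the intersection over `m` of the closures of
`FS(⟨x_n⟩_{n ≥ m})` in `βS` meets `K(βS)`. -/
def IsMinimalSequence {S : Type*} [AddCommMonoid S] (x : ℕ → S) : Prop :=
  ((⋂ m : ℕ, {p : Ultrafilter S | finiteSumsFrom x m ∈ p}) ∩
    smallestIdeal (Ultrafilter S)).Nonempty

/-- `⟨x_n⟩` is a sum subsystem of `⟨y_n⟩`: there are finite nonempty sets `H_n` of indices with
`max H_n < min H_{n+1}` and `x_n = ∑_{t ∈ H_n} y_t`. -/
def IsSumSubsystem {S : Type*} [AddCommMonoid S] (x y : ℕ → S) : Prop :=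
  ∃ H : ℕ → Finset ℕ, (∀ n, (H n).Nonempty) ∧
    (∀ n, ∀ s ∈ H n, ∀ t ∈ H (n + 1), s < t) ∧
    ∀ n, x n = ∑ t ∈ H n, y t

/-- `AP(⟨x_n⟩)`: the products `x_{n_1} * ⋯ * x_{n_k}`, `k ≥ 1`, over all lists
`n_1, …, n_k` of distinct indices, in any order. -/
def allProducts {S : Type*} [Monoid S] (x : ℕ → S) : Set S :=
  {b | ∃ l : List ℕ, l ≠ [] ∧ l.Nodup ∧ b = (l.map x).prod}

attribute [local instance] Ultrafilter.addSemigroup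

open scoped List

/-! ### The smallest ideal of a semigroup -/

/-! The ultrafilters containing every tail of the finite sums of `y` form a compact semigroup
meeting the smallest ideal, so some minimal idempotent `p` is among them. For nonzero `b`, `c` the
additive map `x ↦ b * x * c` has range containing all multiples of `N = |b|²|c|²`, a subgroup of
finite index; hence it carries minimal idempotents to minimal idempotents, and `{x | b * x * c ∈ A}
∈ p` (`IsMinimalIdempotent.map_mul_mul`). A Galvin-type recursion then picks blocks of `y`. A
product using the new term once is `b * x * c` with `b`, `c` earlier products, so each step imposes
finitely many conditions, all `p`-large. -/

theorem mem_smallestIdeal_iff {T : Type*} [AddSemigroup T] {q : T} :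
    q ∈ smallestIdeal T ↔ ∀ r : T, ∃ s : T, s + (r + q) = q := by
  constructor
  · rintro ⟨I, ⟨⟨-, hI⟩, hmin⟩, hq⟩ r
    -- The left ideal `T + (r + q)` lies in `I`, so minimality makes it contain `q`.
    have hJ : Set.range (· + (r + q)) = I := by
      refine hmin _ ⟨⟨_, q, rfl⟩, ?_⟩ ?_
      · rintro t _ ⟨s, rfl⟩
        exact ⟨t + s, add_assoc _ _ _⟩
      · rintro _ ⟨s, rfl⟩
        exact hI _ _ (hI _ _ hq)
    rwa [← hJ] at hq
  · intro h
    refine ⟨Set.range (· + q), ⟨⟨⟨_, q, rfl⟩, ?_⟩, ?_⟩, ?_⟩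
    · rintro t _ ⟨s, rfl⟩
      exact ⟨t + s, add_assoc _ _ _⟩
    · rintro J ⟨⟨x, hx⟩, hJ⟩ hsub
      refine hsub.antisymm ?_
      obtain ⟨r, rfl⟩ := hsub hx
      obtain ⟨s, hs⟩ := h r
      have hq : q ∈ J := hs ▸ hJ s _ hx
      rintro _ ⟨t, rfl⟩
      exact hJ t _ hq
    · obtain ⟨s, hs⟩ := h q
      exact ⟨s + q, (add_assoc _ _ _).trans hs⟩

/-- A compact subsemigroup that meets the smallest ideal contains a minimal idempotent. -/
theorem exists_isMinimalIdempotent_mem {T : Type*} [AddSemigroup T] [TopologicalSpace T]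
    [CompactSpace T] [T2Space T] (hcont : ∀ r : T, Continuous (· + r)) {C : Set T}
    (hC : IsClosed C) (hadd : ∀ᵉ (a ∈ C) (b ∈ C), a + b ∈ C)
    (hne : (C ∩ smallestIdeal T).Nonempty) : ∃ p ∈ C, IsMinimalIdempotent p := by
  obtain ⟨q, hqC, I, hI, hqI⟩ := hne
  have hIq : Set.range (· + q) = I := by
    refine hI.2 _ ⟨⟨_, q, rfl⟩, ?_⟩ ?_
    · rintro t _ ⟨s, rfl⟩
      exact ⟨t + s, add_assoc _ _ _⟩
    · rintro _ ⟨s, rfl⟩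
      exact hI.1.2 _ _ hqI
  have hIc : IsClosed I := hIq ▸ (isCompact_range (hcont q)).isClosed
  obtain ⟨p, ⟨hpC, hpI⟩, hp⟩ := exists_idempotent_in_compact_add_subsemigroup hcont (C ∩ I)
    ⟨q, hqC, hqI⟩ (hC.inter hIc).isCompact
    (fun a ha b hb => ⟨hadd a ha.1 b hb.1, hI.1.2 _ _ hb.2⟩)
  exact ⟨p, hpC, hp, I, hI, hpI⟩

/-! ### Ultrafilters on additive groups -/

theorem Ultrafilter.mem_add_iff {S : Type*} [Add S] {p q : Ultrafilter S} {A : Set S} :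
    A ∈ p + q ↔ {x | {y | x + y ∈ A} ∈ q} ∈ p :=
  Iff.rfl

theorem Ultrafilter.map_add {S T F : Type*} [Add S] [Add T] [FunLike F S T] [AddHomClass F S T]
    (f : F) (p q : Ultrafilter S) : (p + q).map f = p.map f + q.map f := by
  ext A
  simp only [Ultrafilter.mem_map, Ultrafilter.mem_add_iff, Set.mem_preimage, _root_.map_add]
  rfl

theorem Ultrafilter.exists_map_eq {S T : Type*} {f : S → T} {p : Ultrafilter T}
    (h : Set.range f ∈ p) : ∃ q : Ultrafilter S, q.map f = p := by
  have : (Filter.comap f (p : Filter T)).NeBot := Filter.NeBot.comap_of_range_mem p.neBot h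
  refine ⟨Ultrafilter.of (Filter.comap f p), Ultrafilter.eq_of_le ?_⟩
  rw [Ultrafilter.coe_map]
  exact (Filter.map_mono (Ultrafilter.of_le _)).trans Filter.map_comap_le

/-- Once a nonprincipal ultrafilter has been added on the left of `pure a`, no further left addition
can return to `pure a`: for fixed `x`, only `y = -x` solves `x + (y + a) = a`. -/
theorem Ultrafilter.ne_pure_of_mem_smallestIdeal {S : Type*} [AddGroup S] [Infinite S]
    {p : Ultrafilter S} (hp : p ∈ smallestIdeal (Ultrafilter S)) (a : S) : p ≠ pure a := by
  rintro rfl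
  obtain ⟨s, hs⟩ := mem_smallestIdeal_iff.1 hp (Filter.hyperfilter S)
  have h : ({a} : Set S) ∈ s + (Filter.hyperfilter S + pure a) := by
    rw [hs]
    exact Set.mem_singleton a
  obtain ⟨x, hx⟩ := s.nonempty_of_mem (Ultrafilter.mem_add_iff.1 h)
  refine Filter.notMem_hyperfilter_of_finite (Set.finite_singleton (-x)) ?_
  filter_upwards [Ultrafilter.mem_add_iff.1 hx] with y hy
  have hy' : x + (y + a) = a := hy
  rw [← add_assoc, add_eq_right] at hy'
  exact eq_neg_of_add_eq_zero_right hy'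

/-- An endomorphism whose range contains the kernel of a homomorphism to a finite group
preserves the smallest ideal of the space of ultrafilters. -/
theorem Ultrafilter.map_mem_smallestIdeal {S G : Type*} [AddGroup S] [AddGroup G] [Finite G]
    (φ : S →+ G) (f : S →+ S) (hf : ∀ x, φ x = 0 → x ∈ Set.range f) {p : Ultrafilter S}
    (hp : p ∈ smallestIdeal (Ultrafilter S)) : p.map f ∈ smallestIdeal (Ultrafilter S) := by
  rw [mem_smallestIdeal_iff] at hp ⊢
  intro r
  -- Since `G` is finite, `r` lives on a single coset of the kernel. Translation by `-g` moves it
  -- into the range of `f`, so it becomes the image of some `r'`, and the return from `r' + p` to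
  -- `p` can be pushed forward along `f`.
  obtain ⟨v, hv⟩ := (r.map φ).eq_pure_of_finite
  have hr : {x | φ x = v} ∈ r := by
    have : ({v} : Set G) ∈ r.map φ := by
      rw [hv]
      exact Set.mem_singleton v
    exact this
  obtain ⟨g, hg⟩ := r.nonempty_of_mem hr
  have hrange : Set.range f ∈ pure (-g) + r := by
    change {y | -g + y ∈ Set.range f} ∈ r
    filter_upwards [hr] with y hy
    exact hf _ (by rw [_root_.map_add, map_neg, hg, hy, neg_add_cancel])
  obtain ⟨r', hr'⟩ := Ultrafilter.exists_map_eq hrange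
  obtain ⟨s, hs⟩ := hp r'
  refine ⟨s.map f + pure (-g), ?_⟩
  rw [← add_assoc, add_assoc (s.map f), ← hr', add_assoc, ← Ultrafilter.map_add,
    ← Ultrafilter.map_add, hs]

theorem IsMinimalIdempotent.map {S G : Type*} [AddGroup S] [AddGroup G] [Finite G]
    (φ : S →+ G) (f : S →+ S) (hf : ∀ x, φ x = 0 → x ∈ Set.range f) {p : Ultrafilter S}
    (hp : IsMinimalIdempotent p) : IsMinimalIdempotent (p.map f) :=
  ⟨by rw [← Ultrafilter.map_add, hp.1], Ultrafilter.map_mem_smallestIdeal φ f hf hp.2⟩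

/-! ### Minimal sequences -/

/-- The ultrafilters that contain all tails of the finite sums of a sequence are closed under
addition. -/
theorem finiteSumsFrom_mem_add {S : Type*} [AddCommMonoid S] {y : ℕ → S} {p q : Ultrafilter S}
    (hp : ∀ m, finiteSumsFrom y m ∈ p) (hq : ∀ m, finiteSumsFrom y m ∈ q) (m : ℕ) :
    finiteSumsFrom y m ∈ p + q := by
  rw [Ultrafilter.mem_add_iff]
  filter_upwards [hp m]
  rintro _ ⟨F, hF, hFm, rfl⟩
  filter_upwards [hq (F.sup id + 1)]
  rintro _ ⟨E, -, hE, rfl⟩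
  have hlt : ∀ s ∈ F, ∀ t ∈ E, s < t := fun s hs t ht =>
    Nat.lt_of_lt_of_le (Nat.lt_succ_of_le (Finset.le_sup (f := id) hs)) (hE t ht)
  have hdisj : Disjoint F E :=
    Finset.disjoint_left.2 fun t ht ht' => lt_irrefl _ (hlt t ht t ht')
  refine ⟨F ∪ E, hF.mono Finset.subset_union_left, ?_, (Finset.sum_union hdisj).symm⟩
  intro t ht
  rcases Finset.mem_union.1 ht with h | h
  · exact hFm t h
  · obtain ⟨s, hs⟩ := hF
    exact (hFm s hs).trans (hlt s hs t h).le

theorem IsMinimalSequence.exists_isMinimalIdempotent {S : Type*} [AddCommMonoid S] {y : ℕ → S}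
    (hy : IsMinimalSequence y) :
    ∃ p : Ultrafilter S, IsMinimalIdempotent p ∧ ∀ m, finiteSumsFrom y m ∈ p := by
  obtain ⟨p, hp, hmin⟩ := exists_isMinimalIdempotent_mem Ultrafilter.continuous_add_left
    (isClosed_iInter fun m => ultrafilter_isClosed_basic (finiteSumsFrom y m))
    (fun a ha b hb => Set.mem_iInter.2 fun m =>
      finiteSumsFrom_mem_add (Set.mem_iInter.1 ha) (Set.mem_iInter.1 hb) m) hy
  exact ⟨p, hmin, Set.mem_iInter.1 hp⟩

/-! ### The recursive construction -/

/-- Dependent choice whose state is the whole history, newest term first. -/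
theorem exists_seq_of_forall_list {α : Type*} (Q : List α → Prop) (h0 : Q [])
    (hstep : ∀ l, Q l → ∃ a, Q (a :: l)) :
    ∃ f : ℕ → α, ∀ n, Q ((List.range n).reverse.map f) := by
  choose g hg using fun l : {l // Q l} => hstep l.1 l.2
  let s : ℕ → {l // Q l} := fun n => Nat.rec ⟨[], h0⟩ (fun _ l => ⟨g l :: l.1, hg l⟩) n
  refine ⟨fun n => g (s n), fun n => ?_⟩
  have : (List.range n).reverse.map (fun n => g (s n)) = (s n).1 := by
    induction n with
    | zero => rfl
    | succ n ih => simp [List.range_succ, s] at ih ⊢; exact ih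
  rw [this]
  exact (s n).2

theorem List.finite_setOf_subperm {α : Type*} (l : List α) : {s | s <+~ l}.Finite := by
  refine (l.sublists.flatMap List.permutations).finite_toSet.subset ?_
  rintro s ⟨t, hts, htl⟩
  simp only [Set.mem_ofPred_eq, List.mem_flatMap, List.mem_sublists, List.mem_permutations]
  exact ⟨t, htl, hts.symm⟩

theorem List.Subperm.map_of {α β : Type*} {l l' : List α} (h : l <+~ l') (f : α → β) :
    l.map f <+~ l'.map f := by
  obtain ⟨t, ht, hs⟩ := h
  exact ⟨t.map f, ht.map f, hs.map f⟩

/-- A list that is contained in `a :: l` up to order either is contained in `l` or arises by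
inserting `a` into a list that is. -/
theorem List.Subperm.of_cons_right {α : Type*} {a : α} {s l : List α} (h : s <+~ a :: l) :
    s <+~ l ∨ ∃ u v, s = u ++ a :: v ∧ u ++ v <+~ l := by
  obtain ⟨t, hts, htl⟩ := h
  rcases List.sublist_cons_iff.1 htl with htl | ⟨r, rfl, hr⟩
  · exact .inl ⟨t, hts, htl⟩
  · obtain ⟨u, v, rfl⟩ := List.append_of_mem (hts.subset List.mem_cons_self)
    refine .inr ⟨u, v, rfl, r, ?_, hr⟩
    exact (List.perm_cons a).1 (hts.trans List.perm_middle)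

/-- Galvin's trick: a member of an idempotent `p` contains the member of those of its elements
by which it may be shifted. -/
theorem Ultrafilter.exists_subset_shift_mem {S : Type*} [AddSemigroup S] {p : Ultrafilter S}
    (hp : p + p = p) {A : Set S} (hA : A ∈ p) :
    ∃ B ⊆ A, B ∈ p ∧ ∀ a ∈ B, {x | a + x ∈ B} ∈ p := by
  have key : ∀ C ∈ p, {a | {x | a + x ∈ C} ∈ p} ∈ p := fun C hC =>
    Ultrafilter.mem_add_iff.1 (hp.symm ▸ hC)
  refine ⟨A ∩ {a | {x | a + x ∈ A} ∈ p}, Set.inter_subset_left,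
    Filter.inter_mem hA (key A hA), ?_⟩
  rintro a ⟨-, ha⟩
  filter_upwards [ha, key _ ha] with x hx hx'
  refine ⟨hx, ?_⟩
  simpa only [Set.mem_ofPred_eq, add_assoc] using hx'

/-- If all two-sided multiplicative shifts of `A` belong to an idempotent which contains the tails
of `FS(⟨y_n⟩)`, then some sum subsystem of `⟨y_n⟩` has all its sums and products in `A`. -/
theorem exists_isSumSubsystem_of_idempotent {R : Type*} [Ring R] [IsDomain R]
    {A : Set R} {p : Ultrafilter R} (hp : p + p = p) (hp0 : {x | x ≠ 0} ∈ p)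
    (hA : ∀ b c : R, b ≠ 0 → c ≠ 0 → {x | b * x * c ∈ A} ∈ p)
    {y : ℕ → R} (hy : ∀ m, finiteSumsFrom y m ∈ p) :
    ∃ x : ℕ → R, IsSumSubsystem x y ∧ finiteSums x ∪ allProducts x ⊆ A := by
  obtain ⟨B, hBA, hBp, hB⟩ := Ultrafilter.exists_subset_shift_mem hp
    (A := A) (by simpa using hA 1 1 one_ne_zero one_ne_zero)
  let σ : Finset ℕ → R := fun H => ∑ t ∈ H, y t
  -- Sublists up to permutation encode all orders of distinct factors. Nonvanishing covers the empty
  -- product too, so the new term may stand at either end.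
  let Q : List (Finset ℕ) → Prop := fun l =>
    (∀ H ∈ l, H.Nonempty) ∧ l.Pairwise (fun H' H => ∀ s ∈ H, ∀ t ∈ H', s < t) ∧
    ∀ s, s <+~ l → (s.map σ).prod ≠ 0 ∧
      (s ≠ [] → (s.map σ).sum ∈ B ∧ (s.map σ).prod ∈ A)
  have hstep : ∀ l, Q l → ∃ H, Q (H :: l) := by
    rintro l ⟨hne, hlt, hl⟩
    obtain ⟨m, hm⟩ : ∃ m, ∀ H ∈ l, ∀ s ∈ H, s < m := by
      refine ⟨l.toFinset.sup (fun H => H.sup id) + 1, fun H hH s hs => Nat.lt_succ_of_le ?_⟩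
      exact (Finset.le_sup (f := id) hs).trans
        (Finset.le_sup (f := fun H : Finset ℕ => H.sup id) (List.mem_toFinset.2 hH))
    have hfin := List.finite_setOf_subperm l
    have hsum : ∀ᶠ x in p, ∀ s ∈ {s | s <+~ l}, s ≠ [] → (s.map σ).sum + x ∈ B := by
      refine (Filter.eventually_all_finite hfin).2 fun s hs => ?_
      by_cases h : s = []
      · exact .of_forall fun x h' => absurd h h'
      · exact Filter.mem_of_superset (hB _ ((hl s hs).2 h).1) fun x hx _ => hx
    have hprod : ∀ᶠ x in p, ∀ u ∈ {s | s <+~ l}, ∀ v ∈ {s | s <+~ l},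
        (u.map σ).prod * x * (v.map σ).prod ∈ A :=
      (Filter.eventually_all_finite hfin).2 fun u hu =>
        (Filter.eventually_all_finite hfin).2 fun v hv => hA _ _ (hl u hu).1 (hl v hv).1
    obtain ⟨_, hxB, hx0, ⟨H, hH, hHm, rfl⟩, hxs, hxp⟩ :=
      (Filter.Eventually.and (f := (p : Filter R)) hBp <|
        Filter.Eventually.and (f := (p : Filter R)) (p := fun x => x ≠ 0) hp0 <|
        Filter.Eventually.and (f := (p : Filter R)) (hy m) <| hsum.and hprod).exists
    refine ⟨H, ?_, ?_, fun s hs => ?_⟩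
    · rintro E hE
      rcases List.mem_cons.1 hE with rfl | hE
      exacts [hH, hne E hE]
    · exact List.pairwise_cons.2
        ⟨fun E hE s hs t ht => (hm E hE s hs).trans_le (hHm t ht), hlt⟩
    · rcases hs.of_cons_right with hs | ⟨u, v, rfl, huv⟩
      · exact hl s hs
      · have hu : u <+~ l := (List.sublist_append_left u v).subperm.trans huv
        have hv : v <+~ l := (List.sublist_append_right u v).subperm.trans huv
        have hpr : ((u ++ H :: v).map σ).prod = (u.map σ).prod * σ H * (v.map σ).prod := by
          simp [mul_assoc]
        have hsm : ((u ++ H :: v).map σ).sum = ((u ++ v).map σ).sum + σ H := by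
          simp only [List.map_append, List.map_cons, List.sum_append, List.sum_cons]
          abel
        refine ⟨?_, fun _ => ⟨?_, ?_⟩⟩
        · rw [hpr]
          exact mul_ne_zero (mul_ne_zero (hl u hu).1 hx0) (hl v hv).1
        · rw [hsm]
          by_cases h : u ++ v = []
          · rw [h, List.map_nil, List.sum_nil, zero_add]
            exact hxB
          · exact hxs _ huv h
        · rw [hpr]
          exact hxp u hu v hv
  have h0 : Q [] := by
    refine ⟨by simp, List.Pairwise.nil, fun s hs => ?_⟩
    obtain rfl := List.subperm_nil.1 hs
    simp
  obtain ⟨H, hH⟩ := exists_seq_of_forall_list Q h0 hstep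
  have hlist : ∀ l : List ℕ, l ≠ [] → l.Nodup →
      (l.map fun n => σ (H n)).sum ∈ B ∧ (l.map fun n => σ (H n)).prod ∈ A := by
    intro l hl hnd
    have hsub : l <+~ (List.range (l.toFinset.sup id + 1)).reverse := by
      refine List.subperm_of_subset hnd fun n hn => ?_
      rw [List.mem_reverse, List.mem_range]
      exact Nat.lt_succ_of_le (Finset.le_sup (f := id) (List.mem_toFinset.2 hn))
    have := ((hH _).2.2 _ (hsub.map_of H)).2 (by simpa using hl)
    simpa only [List.map_map, Function.comp_def] using this
  refine ⟨fun n => σ (H n), ⟨H, fun n => ?_, fun n => ?_, fun n => rfl⟩, ?_⟩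
  · exact (hH (n + 1)).1 _ (by simp [List.range_succ])
  -- At stage `n + 2` the two head entries are the blocks `n + 1` and `n`.
  · have := (hH (n + 2)).2.1
    simp only [List.range_succ, List.reverse_append, List.reverse_cons, List.reverse_nil,
      List.nil_append, List.cons_append, List.map_cons, List.pairwise_cons] at this
    exact this.1 _ List.mem_cons_self
  · rintro _ (⟨F, hF, rfl⟩ | ⟨l, hl, hnd, rfl⟩)
    · rw [← Finset.sum_map_toList]
      exact hBA (hlist _ (by simpa using hF.ne_empty) F.nodup_toList).1
    · exact (hlist l hl hnd).2

/-! ### Integer quaternions -/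

/-- Reduction of the coordinates of an integer quaternion modulo `N`. -/
def Quaternion.reduceMod (N : ℕ) :
    Quaternion ℤ →+ ZMod N × ZMod N × ZMod N × ZMod N where
  toFun x := (x.re, x.imI, x.imJ, x.imK)
  map_zero' := by simp
  map_add' x y := by simp

theorem Quaternion.exists_eq_mul_of_reduceMod_eq_zero {N : ℕ} {x : Quaternion ℤ}
    (h : Quaternion.reduceMod N x = 0) : ∃ z : Quaternion ℤ, x = ((N : ℤ) : Quaternion ℤ) * z := by
  simp only [Quaternion.reduceMod, AddMonoidHom.coe_mk, ZeroHom.coe_mk, Prod.mk_eq_zero,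
    ZMod.intCast_zmod_eq_zero_iff_dvd] at h
  obtain ⟨⟨a, ha⟩, ⟨b, hb⟩, ⟨c, hc⟩, ⟨d, hd⟩⟩ := h
  obtain ⟨z, rfl, rfl, rfl, rfl⟩ : ∃ z : Quaternion ℤ,
      z.re = a ∧ z.imI = b ∧ z.imJ = c ∧ z.imK = d :=
    ⟨⟨a, b, c, d⟩, rfl, rfl, rfl, rfl⟩
  refine ⟨z, ?_⟩
  rw [← zsmul_eq_mul]
  ext <;> simp [*]

/-- Two-sided multiplication by nonzero integer quaternions preserves minimal idempotents. -/
theorem IsMinimalIdempotent.map_mul_mul {p : Ultrafilter (Quaternion ℤ)}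
    (hp : IsMinimalIdempotent p) {b c : Quaternion ℤ} (hb : b ≠ 0) (hc : c ≠ 0) :
    IsMinimalIdempotent (p.map fun x => b * x * c) := by
  obtain ⟨m, hm⟩ := Int.eq_ofNat_of_zero_le (Quaternion.normSq_nonneg (a := b))
  obtain ⟨n, hn⟩ := Int.eq_ofNat_of_zero_le (Quaternion.normSq_nonneg (a := c))
  have hm0 : m ≠ 0 := by
    rintro rfl
    exact hb (Quaternion.normSq_eq_zero.1 hm)
  have hn0 : n ≠ 0 := by
    rintro rfl
    exact hc (Quaternion.normSq_eq_zero.1 hn)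
  have : NeZero (m * n) := ⟨mul_ne_zero hm0 hn0⟩
  refine hp.map (Quaternion.reduceMod (m * n))
    ((AddMonoidHom.mulRight c).comp (AddMonoidHom.mulLeft b)) fun x hx => ?_
  obtain ⟨z, rfl⟩ := Quaternion.exists_eq_mul_of_reduceMod_eq_zero hx
  -- The conjugates turn `b` and `c` into their norms, which are central.
  refine ⟨star b * z * star c, ?_⟩
  have hbb : b * star b = (m : Quaternion ℤ) := by
    rw [Quaternion.self_mul_star, hm]; rfl
  have hcc : star c * c = (n : Quaternion ℤ) := by
    rw [Quaternion.star_mul_self, hn]; rfl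
  calc b * (star b * z * star c) * c = (b * star b) * z * (star c * c) := by
        simp only [mul_assoc]
    _ = _ := by
        rw [hbb, hcc, mul_assoc, ← Nat.cast_comm n z]
        push_cast
        rw [mul_assoc]

/-- The ring of Lipschitz integer quaternions is Mathlib's `Quaternion ℤ`. -/
theorem theorem3p5 (A : Set (Quaternion ℤ)) (hA : IsCentralStar A)
    (y : ℕ → Quaternion ℤ) (hy : IsMinimalSequence y) :
    ∃ x : ℕ → Quaternion ℤ, IsSumSubsystem x y ∧ finiteSums x ∪ allProducts x ⊆ A := by
  obtain ⟨p, hp, hpy⟩ := hy.exists_isMinimalIdempotent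
  have : Infinite (Quaternion ℤ) :=
    Infinite.of_injective (fun n : ℤ => (⟨n, 0, 0, 0⟩ : Quaternion ℤ))
      fun m n h => congrArg QuaternionAlgebra.re h
  refine exists_isSumSubsystem_of_idempotent hp.1 ?_
    (fun b c hb hc => hA _ (hp.map_mul_mul hb hc)) hpy
  refine Ultrafilter.compl_mem_iff_notMem.2 fun h => ?_
  obtain ⟨a, -, ha⟩ := Ultrafilter.eq_pure_of_finite_mem (Set.finite_singleton (0 : Quaternion ℤ)) h
  exact Ultrafilter.ne_pure_of_mem_smallestIdeal hp.2 a ha
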